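/- Call a function $f:\mathbb{R}^n\to\mathbb{R}$ \emph{piecewise affine} if it is continuous and there are finitely many affine functions $g_1,\dots,g_k:\mathbb{R}^n\to\mathbb{R}$ such that $f(x)\in\{g_1(x),\dots,g_k(x)\}$ for every $x\in\mathbb{R}^n$. The \emph{horizon function} $f^\infty:\mathbb{R}^n\to[-\infty,+\infty]$ of $f$ is $$f^\infty(\xi)=\lim_{\delta\downarrow 0}\,\inf\bigl\{\lambda f(x/\lambda) : 0<\lambda<\delta,\ \|x-\xi\|<\delta\bigr\},$$ where $\|\cdot\|$ is the Euclidean norm. Let $f:\mathbb{R}^n\to\mathbb{R}$ be piecewise affine, and let $X\subset\mathbb{R}^n$ be any set with $0$ in its interior. Then $f$ attains a global minimum on $\mathbb{R}^n$ if and only if $\inf_{\xi\in X}f^\infty(\xi)=0$. -/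

import Mathlib

open Filter Topology

/-- A function between normed spaces is piecewise affine if it is continuous and its values are
selected from finitely many affine functions (the affine pieces). -/
def IsPiecewiseAffine {E F : Type*} [NormedAddCommGroup E] [NormedSpace ℝ E]
    [NormedAddCommGroup F] [NormedSpace ℝ F] (f : E → F) : Prop :=
  Continuous f ∧ ∃ S : Set (E →ᵃ[ℝ] F), S.Finite ∧ ∀ x, ∃ g ∈ S, f x = g x

/-- The infimum, in the extended reals, of `λ f (x / λ)` over `0 < λ < δ` and `‖x - ξ‖ < δ`. -/
noncomputable def horizonInf {E : Type*} [NormedAddCommGroup E] [NormedSpace ℝ E]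
    (f : E → ℝ) (ξ : E) (δ : ℝ) : EReal :=
  sInf {y : EReal | ∃ (l : ℝ) (x : E), 0 < l ∧ l < δ ∧ ‖x - ξ‖ < δ ∧
    y = ((l * f (l⁻¹ • x) : ℝ) : EReal)}

/-- The horizon function of `f`: the limit of `horizonInf f ξ δ` as `δ` decreases to `0`
(the limit always exists, see `tendsto_horizonInf`). -/
noncomputable def horizonFunction {E : Type*} [NormedAddCommGroup E] [NormedSpace ℝ E]
    (f : E → ℝ) (ξ : E) : EReal :=
  limUnder (𝓝[>] (0 : ℝ)) (horizonInf f ξ)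

theorem antitone_horizonInf {E : Type*} [NormedAddCommGroup E] [NormedSpace ℝ E]
    (f : E → ℝ) (ξ : E) : Antitone (horizonInf f ξ) := by
  intro a b hab
  refine sInf_le_sInf ?_
  rintro y ⟨l, x, h0, h1, h2, rfl⟩
  exact ⟨l, x, h0, h1.trans_le hab, h2.trans_le hab, rfl⟩

/-- The limit defining the horizon function exists. -/
theorem tendsto_horizonInf {E : Type*} [NormedAddCommGroup E] [NormedSpace ℝ E]
    (f : E → ℝ) (ξ : E) :
    Tendsto (horizonInf f ξ) (𝓝[>] (0 : ℝ)) (𝓝 (horizonFunction f ξ)) :=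
  tendsto_nhds_limUnder ⟨_, (antitone_horizonInf f ξ).tendsto_nhdsGT 0⟩

/-- An upper bound for the horizon function: the limit of `l * f (l⁻¹ • x l)` along any `x l → ξ`
as `l` decreases to `0`. -/
theorem horizonFunction_le_of_tendsto {E : Type*} [NormedAddCommGroup E] [NormedSpace ℝ E]
    {f : E → ℝ} {ξ : E} {x : ℝ → E} {b : ℝ} (hx : Tendsto x (𝓝[>] 0) (𝓝 ξ))
    (hb : Tendsto (fun l : ℝ => l * f (l⁻¹ • x l)) (𝓝[>] 0) (𝓝 b)) :
    horizonFunction f ξ ≤ (b : EReal) := by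
  refine le_of_tendsto (tendsto_horizonInf f ξ) ?_
  filter_upwards [self_mem_nhdsWithin] with δ hδ
  have hb' : Tendsto (fun l : ℝ => ((l * f (l⁻¹ • x l) : ℝ) : EReal)) (𝓝[>] 0) (𝓝 (b : EReal)) :=
    (continuous_coe_real_ereal.tendsto b).comp hb
  refine ge_of_tendsto hb' ?_
  filter_upwards [hx (Metric.ball_mem_nhds ξ hδ), Ioo_mem_nhdsGT hδ] with l hl hlδ
  exact sInf_le ⟨l, x l, hlδ.1, hlδ.2, by simpa [dist_eq_norm] using hl, rfl⟩

theorem horizonFunction_zero_le {E : Type*} [NormedAddCommGroup E] [NormedSpace ℝ E]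
    (f : E → ℝ) : horizonFunction f 0 ≤ 0 := by
  have h : Tendsto (fun l : ℝ => l * f (l⁻¹ • (0 : E))) (𝓝[>] 0) (𝓝 0) := by
    have : Tendsto (fun l : ℝ => l * f 0) (𝓝 0) (𝓝 (0 * f 0)) := tendsto_id.mul_const _
    simpa using this.mono_left nhdsWithin_le_nhds
  exact_mod_cast horizonFunction_le_of_tendsto tendsto_const_nhds h

/-- The horizon function of a function that is bounded below is nonnegative. -/
theorem horizonFunction_nonneg_of_forall_le {E : Type*} [NormedAddCommGroup E] [NormedSpace ℝ E]
    {f : E → ℝ} {m : ℝ} (hm : ∀ x, m ≤ f x) (ξ : E) : 0 ≤ horizonFunction f ξ := by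
  -- The bound `-|m|` replaces `m` because it is nonpositive: then `l < δ` gives `δ * (-|m|) ≤ l *
  -- (-|m|)`.
  have h : Tendsto (fun δ : ℝ => ((δ * (-|m|) : ℝ) : EReal)) (𝓝[>] 0) (𝓝 0) := by
    have : Tendsto (fun δ : ℝ => δ * (-|m|)) (𝓝 0) (𝓝 (0 * (-|m|))) := tendsto_id.mul_const _
    rw [zero_mul] at this
    exact (continuous_coe_real_ereal.tendsto 0).comp (this.mono_left nhdsWithin_le_nhds)
  refine le_of_tendsto_of_tendsto h (tendsto_horizonInf f ξ) ?_
  filter_upwards with δ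
  refine le_sInf ?_
  rintro y ⟨l, x, hl, hlδ, -, rfl⟩
  refine EReal.coe_le_coe_iff.2 ?_
  calc δ * (-|m|) ≤ l * (-|m|) :=
        mul_le_mul_of_nonpos_right hlδ.le (neg_nonpos.2 (abs_nonneg m))
    _ ≤ l * f (l⁻¹ • x) :=
        mul_le_mul_of_nonneg_left ((neg_abs_le m).trans (hm _)) hl.le

/-- If `f` grows affinely with slope `b` on a ray with direction `d`, then `f^∞ (ε d) ≤ ε b`. -/
theorem horizonFunction_smul_le_of_ray {E : Type*} [NormedAddCommGroup E] [NormedSpace ℝ E]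
    {f : E → ℝ} {y d : E} {a b ε : ℝ} (hε : 0 < ε)
    (h : ∀ t : ℝ, 0 ≤ t → f (y + t • d) = a + t * b) :
    horizonFunction f (ε • d) ≤ ((ε * b : ℝ) : EReal) := by
  -- The shift `l • y` vanishes in the limit and puts the rescaled point `y + (ε / l) • d` exactly
  -- on the ray.
  have hx : Tendsto (fun l : ℝ => l • y + ε • d) (𝓝[>] 0) (𝓝 (ε • d)) := by
    have : Tendsto (fun l : ℝ => l • y + ε • d) (𝓝 0) (𝓝 ((0 : ℝ) • y + ε • d)) :=
      Continuous.tendsto (by fun_prop) 0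
    simpa using this.mono_left nhdsWithin_le_nhds
  refine horizonFunction_le_of_tendsto hx ?_
  have hb : Tendsto (fun l : ℝ => l * a + ε * b) (𝓝[>] 0) (𝓝 (ε * b)) := by
    have : Tendsto (fun l : ℝ => l * a + ε * b) (𝓝 0) (𝓝 (0 * a + ε * b)) :=
      Continuous.tendsto (by fun_prop) 0
    simpa using this.mono_left nhdsWithin_le_nhds
  refine hb.congr' ?_
  filter_upwards [self_mem_nhdsWithin] with l (hl : 0 < l)
  have e : l⁻¹ • (l • y + ε • d) = y + (l⁻¹ * ε) • d := by
    rw [smul_add, smul_smul, smul_smul, inv_mul_cancel₀ hl.ne', one_smul]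
  rw [e, h _ (by positivity)]
  field_simp

/-- A continuous selection from finitely many continuous functions on a preconnected set coincides
with one of them if any two of them agree everywhere or nowhere on that set. -/
theorem IsPreconnected.exists_eqOn_of_selection {α β : Type*} [TopologicalSpace α]
    [TopologicalSpace β] [T2Space β] {s : Set α} (hs : IsPreconnected s) (hne : s.Nonempty)
    {f : α → β} (hf : Continuous f) {S : Set (α → β)} (hS : S.Finite)
    (hc : ∀ g ∈ S, Continuous g) (hsel : ∀ x ∈ s, ∃ g ∈ S, f x = g x)
    (hdisj : ∀ g ∈ S, ∀ g' ∈ S, (∀ x ∈ s, g x = g' x) ∨ ∀ x ∈ s, g x ≠ g' x) :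
    ∃ g ∈ S, ∀ x ∈ s, f x = g x := by
  obtain ⟨x₀, hx₀⟩ := hne
  obtain ⟨g, hg, hfg⟩ := hsel x₀ hx₀
  refine ⟨g, hg, ?_⟩
  -- Agreement with `g` and agreement with a member of `T` are closed conditions that cover `s` and
  -- exclude each other there.
  set T : Set (α → β) := {g' ∈ S | ∀ x ∈ s, g x ≠ g' x}
  have hA : IsClosed {x | f x = g x} := isClosed_eq hf (hc g hg)
  have hB : IsClosed (⋃ g' ∈ T, {x | f x = g' x}) :=
    (hS.subset (Set.sep_subset _ _)).isClosed_biUnion fun g' hg' => isClosed_eq hf (hc g' hg'.1)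
  have hcov : s ⊆ {x | f x = g x} ∪ ⋃ g' ∈ T, {x | f x = g' x} := by
    intro x hx
    obtain ⟨g', hg', h⟩ := hsel x hx
    rcases hdisj g hg g' hg' with h' | h'
    · exact Or.inl (h.trans (h' x hx).symm)
    · exact Or.inr (Set.mem_biUnion (show g' ∈ T from ⟨hg', h'⟩) h)
  by_contra! hcon
  obtain ⟨x, hx, hne⟩ := hcon
  obtain ⟨z, hz, hz1, hz2⟩ := isPreconnected_closed_iff.1 hs _ _ hA hB hcov ⟨x₀, hx₀, hfg⟩
    ⟨x, hx, (hcov hx).resolve_left hne⟩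
  obtain ⟨g', hg', h⟩ := Set.mem_iUnion₂.1 hz2
  exact hg'.2 z hz (hz1.symm.trans h)

/-- If `‖x k‖ → ∞` and `x k / ‖x k‖ → d`, then for large `k` an affine function is identically zero
or nowhere zero on the ray `x k + t d`, `t ≥ -1`. -/
theorem AffineMap.eventually_ray_eq_zero_or_ne_zero {E : Type*} [NormedAddCommGroup E]
    [NormedSpace ℝ E] [FiniteDimensional ℝ E] (h : E →ᵃ[ℝ] ℝ) {x : ℕ → E} {d : E}
    (hx : Tendsto (fun k => ‖x k‖) atTop atTop)
    (hd : Tendsto (fun k => ‖x k‖⁻¹ • x k) atTop (𝓝 d)) :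
    ∀ᶠ k in atTop, (∀ t ∈ Set.Ici (-1 : ℝ), h (x k + t • d) = 0) ∨
      ∀ t ∈ Set.Ici (-1 : ℝ), h (x k + t • d) ≠ 0 := by
  have key : ∀ h : E →ᵃ[ℝ] ℝ, 0 < h.linear d →
      ∀ᶠ k in atTop, ∀ t ∈ Set.Ici (-1 : ℝ), 0 < h (x k + t • d) := by
    intro h hpos
    have h1 : Tendsto (fun k => h.linear (‖x k‖⁻¹ • x k)) atTop (𝓝 (h.linear d)) :=
      (h.linear.continuous_of_finiteDimensional.tendsto d).comp hd
    have h2 : Tendsto (fun k => ‖x k‖ * h.linear (‖x k‖⁻¹ • x k) + h 0) atTop atTop :=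
      tendsto_atTop_add_const_right _ _ (hx.atTop_mul_pos hpos h1)
    -- Exceeding `h.linear d` covers the worst case `t = -1`.
    filter_upwards [h2.eventually_gt_atTop (h.linear d), hx.eventually_gt_atTop 0]
      with k hk hk0 t ht
    have e : h (x k + t • d) = h.linear (x k) + h 0 + t * h.linear d := by
      have := h.map_vadd 0 (x k + t • d)
      simp only [vadd_eq_add, add_zero, map_add, map_smul, smul_eq_mul] at this
      rw [this]; ring
    rw [map_smul, smul_eq_mul, mul_inv_cancel_left₀ hk0.ne'] at hk
    rw [e]
    nlinarith [mul_le_mul_of_nonneg_right (Set.mem_Ici.1 ht) hpos.le]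
  rcases lt_trichotomy (h.linear d) 0 with hneg | h0 | hpos
  · filter_upwards [key (-h) (by simpa using hneg)] with k hk
    exact Or.inr fun t ht => by simpa using (hk t ht).ne'
  · refine Eventually.of_forall fun k => ?_
    have e : ∀ t : ℝ, h (x k + t • d) = h (x k) := fun t => by
      have := h.map_vadd (x k) (t • d)
      rw [map_smul, h0, smul_zero, vadd_eq_add, vadd_eq_add, zero_add, add_comm] at this
      exact this
    by_cases hk : h (x k) = 0
    · exact Or.inl fun t _ => (e t).trans hk
    · exact Or.inr fun t _ => by rwa [e t]
  · filter_upwards [key h hpos] with k hk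
    exact Or.inr fun t ht => (hk t ht).ne'

/-- If `‖x k‖ → ∞` and `x k / ‖x k‖ → d`, then for large `k` a piecewise affine function is affine
on the ray `x k + t d`, `t ≥ -1`. -/
theorem IsPiecewiseAffine.eventually_affine_on_ray {E : Type*} [NormedAddCommGroup E]
    [NormedSpace ℝ E] [FiniteDimensional ℝ E] {f : E → ℝ} (hf : IsPiecewiseAffine f)
    {x : ℕ → E} {d : E} (hx : Tendsto (fun k => ‖x k‖) atTop atTop)
    (hd : Tendsto (fun k => ‖x k‖⁻¹ • x k) atTop (𝓝 d)) :
    ∀ᶠ k in atTop, ∃ b : ℝ, ∀ t ∈ Set.Ici (-1 : ℝ), f (x k + t • d) = f (x k) + t * b := by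
  obtain ⟨hcont, S, hS, hsel⟩ := hf
  have hev : ∀ᶠ k in atTop, ∀ p ∈ S ×ˢ S,
      (∀ t ∈ Set.Ici (-1 : ℝ), (p.1 - p.2) (x k + t • d) = 0) ∨
      ∀ t ∈ Set.Ici (-1 : ℝ), (p.1 - p.2) (x k + t • d) ≠ 0 :=
    ((hS.prod hS).eventually_all).2 fun p _ =>
      (p.1 - p.2).eventually_ray_eq_zero_or_ne_zero hx hd
  filter_upwards [hev] with k hk
  have hray : Continuous fun t : ℝ => x k + t • d := by fun_prop
  obtain ⟨_, ⟨g, -, rfl⟩, hfg⟩ := isPreconnected_Ici.exists_eqOn_of_selection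
    (s := Set.Ici (-1 : ℝ)) ⟨-1, Set.self_mem_Ici⟩ (hcont.comp hray)
    (hS.image fun g : E →ᵃ[ℝ] ℝ => fun t : ℝ => g (x k + t • d))
    (by
      rintro _ ⟨g, -, rfl⟩
      exact g.continuous_of_finiteDimensional.comp hray)
    (fun t _ => by
      obtain ⟨g, hg, h⟩ := hsel (x k + t • d)
      exact ⟨_, ⟨g, hg, rfl⟩, h⟩)
    (by
      rintro _ ⟨g, hg, rfl⟩ _ ⟨g', hg', rfl⟩
      simpa [sub_eq_zero] using hk (g, g') ⟨hg, hg'⟩)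
  have hline : ∀ t ∈ Set.Ici (-1 : ℝ), f (x k + t • d) = g (x k) + t * g.linear d := by
    intro t ht
    have := g.map_vadd (x k) (t • d)
    rw [map_smul, smul_eq_mul, vadd_eq_add, vadd_eq_add, add_comm, add_comm (t * _)] at this
    exact (hfg t ht).trans this
  refine ⟨g.linear d, fun t ht => ?_⟩
  have h0 := hline 0 (by simp)
  rw [zero_smul, add_zero, zero_mul, add_zero] at h0
  rw [hline t ht, h0]

/-- If `‖x k‖ → ∞` and `x k / ‖x k‖ → d`, then `x k - d` is shorter than `x k` for large `k`. -/
theorem eventually_norm_sub_lt_of_tendsto_direction {E : Type*} [NormedAddCommGroup E]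
    [InnerProductSpace ℝ E] {x : ℕ → E} {d : E} (hx : Tendsto (fun k => ‖x k‖) atTop atTop)
    (hd : Tendsto (fun k => ‖x k‖⁻¹ • x k) atTop (𝓝 d)) :
    ∀ᶠ k in atTop, ‖x k - d‖ < ‖x k‖ := by
  have hd1 : ‖d‖ = 1 := by
    refine tendsto_nhds_unique hd.norm (tendsto_const_nhds.congr' ?_)
    filter_upwards [hx.eventually_gt_atTop 0] with k hk
    rw [norm_smul, norm_inv, norm_norm, inv_mul_cancel₀ hk.ne']
  have h1 : Tendsto (fun k => inner ℝ (‖x k‖⁻¹ • x k) d) atTop (𝓝 (1 : ℝ)) := by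
    have := hd.inner (𝕜 := ℝ) (tendsto_const_nhds (x := d))
    rwa [real_inner_self_eq_norm_sq, hd1, one_pow] at this
  have h2 : Tendsto (fun k => ‖x k‖ * inner ℝ (‖x k‖⁻¹ • x k) d) atTop atTop :=
    hx.atTop_mul_pos one_pos h1
  -- Since `‖d‖ = 1`, the claim only needs `2⟪x k, d⟫ > 1`.
  filter_upwards [h2.eventually_gt_atTop 1, hx.eventually_gt_atTop 0] with k hk hk0
  rw [real_inner_smul_left, mul_inv_cancel_left₀ hk0.ne'] at hk
  refine lt_of_pow_lt_pow_left₀ 2 (norm_nonneg _) ?_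
  rw [norm_sub_sq_real, hd1]
  linarith

/-- A nonempty closed set in a proper space has a point of least norm. -/
theorem IsClosed.exists_norm_le {E : Type*} [NormedAddCommGroup E] [ProperSpace E] {s : Set E}
    (hs : IsClosed s) (hne : s.Nonempty) : ∃ x ∈ s, ∀ y ∈ s, ‖x‖ ≤ ‖y‖ := by
  obtain ⟨x, hx, h⟩ := hs.exists_infDist_eq_dist hne 0
  refine ⟨x, hx, fun y hy => ?_⟩
  rw [← dist_zero_left x, ← dist_zero_left y, ← h]
  exact Metric.infDist_le_dist_of_mem hy

/-- A piecewise affine function whose horizon function is nonnegative near `0` attains its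
minimum. -/
theorem IsPiecewiseAffine.exists_forall_le {E : Type*} [NormedAddCommGroup E]
    [InnerProductSpace ℝ E] [FiniteDimensional ℝ E] {f : E → ℝ} (hf : IsPiecewiseAffine f)
    (h0 : ∀ᶠ ξ in 𝓝 0, 0 ≤ horizonFunction f ξ) : ∃ x₀, ∀ x, f x₀ ≤ f x := by
  have : ProperSpace E := FiniteDimensional.proper_real E
  have hcont : Continuous f := hf.1
  suffices h : ∃ R : ℕ, ∀ x, ∃ y, f y ≤ f x ∧ ‖y‖ ≤ R by
    obtain ⟨R, hR⟩ := h
    obtain ⟨x₀, -, hmin⟩ := (isCompact_closedBall (0 : E) R).exists_isMinOn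
      ⟨0, by simp⟩ hcont.continuousOn
    refine ⟨x₀, fun x => ?_⟩
    obtain ⟨y, hy, hyR⟩ := hR x
    exact (hmin (by simpa using hyR)).trans hy
  by_contra! hcon
  choose z hz using hcon
  have hex : ∀ k, ∃ x ∈ {y | f y ≤ f (z k)}, ∀ y ∈ {y | f y ≤ f (z k)}, ‖x‖ ≤ ‖y‖ := fun k =>
    (isClosed_le hcont continuous_const).exists_norm_le ⟨z k, le_refl (f (z k))⟩
  choose x hxz hxmin using hex
  have hxtop : Tendsto (fun k => ‖x k‖) atTop atTop :=
    tendsto_atTop_mono (fun k => (hz k (x k) (hxz k)).le) tendsto_natCast_atTop_atTop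
  have hball : ∀ k, ‖x k‖⁻¹ • x k ∈ Metric.closedBall (0 : E) 1 := fun k => by
    rw [mem_closedBall_zero_iff, norm_smul, norm_inv, norm_norm]
    exact inv_mul_le_one
  obtain ⟨d, -, φ, hφ, hd⟩ := (isCompact_closedBall (0 : E) 1).tendsto_subseq hball
  have hxφ : Tendsto (fun k => ‖x (φ k)‖) atTop atTop := hxtop.comp hφ.tendsto_atTop
  obtain ⟨k, ⟨b, hb⟩, hlt⟩ := ((hf.eventually_affine_on_ray hxφ hd).and
    (eventually_norm_sub_lt_of_tendsto_direction hxφ hd)).exists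
  have hsmall : ∀ᶠ ε : ℝ in 𝓝[>] 0, 0 ≤ horizonFunction f (ε • d) := by
    have : Tendsto (fun ε : ℝ => ε • d) (𝓝 0) (𝓝 0) := by
      simpa using (show Continuous fun ε : ℝ => ε • d by fun_prop).tendsto 0
    exact (this.mono_left nhdsWithin_le_nhds).eventually h0
  obtain ⟨ε, hε, hεpos⟩ := (hsmall.and self_mem_nhdsWithin).exists
  have hb0 : 0 ≤ ε * b := by
    have := hε.trans (horizonFunction_smul_le_of_ray hεpos fun t ht =>
      hb t (Set.mem_Ici.2 (by linarith)))
    exact_mod_cast this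
  have hb1 : 0 ≤ b := nonneg_of_mul_nonneg_right hb0 hεpos
  -- This backward step is why the rays start at `t = -1`; the slope bound used only `t ≥ 0`.
  have hstep := hb (-1) Set.self_mem_Ici
  rw [neg_one_smul, ← sub_eq_add_neg] at hstep
  have hle : f (x (φ k) - d) ≤ f (z (φ k)) := by
    have := hxz (φ k)
    rw [Set.mem_ofPred_eq] at this
    linarith
  exact (hxmin (φ k) _ hle).not_gt hlt

theorem mainTheorem4 (n : ℕ) (f : EuclideanSpace ℝ (Fin n) → ℝ) (hf : IsPiecewiseAffine f)
    (X : Set (EuclideanSpace ℝ (Fin n))) (hX : (0 : EuclideanSpace ℝ (Fin n)) ∈ interior X) :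
    (∃ x₀, ∀ x, f x₀ ≤ f x) ↔ (⨅ ξ ∈ X, horizonFunction f ξ) = 0 := by
  constructor
  · rintro ⟨x₀, hmin⟩
    refine le_antisymm ?_ ?_
    · exact (iInf₂_le 0 (interior_subset hX)).trans (horizonFunction_zero_le f)
    · exact le_iInf₂ fun ξ _ => horizonFunction_nonneg_of_forall_le hmin ξ
  · intro h
    refine hf.exists_forall_le ?_
    filter_upwards [mem_interior_iff_mem_nhds.1 hX] with ξ hξ
    rw [← h]
    exact iInf₂_le ξ hξ
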